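/- Let $d$ be a negative integer such that the Kronecker symbol $\chi(m)=\left(\frac{d}{m}\right)$, $m\in\mathbb{Z}$, is a Dirichlet character modulo $|d|$ (this is the case exactly when $d\equiv 0$ or $1 \pmod 4$; in particular for every negative discriminant $d$). Then the value at $s=1$ of the Dirichlet $L$-function of $\chi$ is a real number, it is the sum of the convergent series $L(1,\chi)=\sum_{n\ge 1}\chi(n)/n$, and $$L(1,\chi)\;\le\;\left(\frac12+\frac1{2\pi}\right)\ln|d|+\frac1\pi\,\ln\ln|d|+1 .$$ -/

import Mathlib

/-- The Kronecker symbol `(a / n)` for arbitrary integers `a` and `n`.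
For `n = u * 2 ^ k * b` with `u = 1` or `u = -1` and `b` odd and positive it is the product
`(a / u) * (a / 2) ^ k * (a / b)`. Here `(a / 1) = 1`; `(a / -1)` is `-1` if `a < 0` and `1`
otherwise; `(a / 2)` is `0` for even `a`, `1` for `a ≡ 1, 7` mod `8`, and `-1` for `a ≡ 3, 5`
mod `8`, which is the value of `ZMod.χ₈`; and `(a / b)` is the Jacobi symbol.
Finally `(a / 0)` is `1` if `a = 1` or `a = -1`, and `0` otherwise. -/
def kroneckerSymbol (a n : ℤ) : ℤ :=
  if n = 0 then (if a = 1 ∨ a = -1 then 1 else 0)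
  else (if n < 0 ∧ a < 0 then -1 else 1) * ZMod.χ₈ (a : ZMod 8) ^ n.natAbs.factorization 2 *
    jacobiSym a (n.natAbs / 2 ^ n.natAbs.factorization 2)

/-!
Let `q = |d|`. The argument combines three ingredients.

*Abel summation.* If the partial sums `S` of a nontrivial character `χ` are bounded by `M ≥ 1`, then
`∑ χ n / n` converges to `∫ S(t) / t²` over `t > 1`, and so does `L(s, χ)` as `s` decreases to `1`
(`tendsto_sum_div_of_bounded_partialSum`, `LFunction_one_eq_integral`). Since also `|S(t)| ≤ t`,
this gives `|L(1, χ)| ≤ log M + 1` (`norm_integral_partialSum_le`).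

*Pólya–Vinogradov.* For a primitive character modulo `f`, the finite Fourier expansion and
`|τ(χ)| = √f` bound the partial sums by `f ^ (-1/2) ∑ 1 / sin (π a / f)`. Comparing this sum with
the integral of `1 / sin`, a convex function, one may take `M = (2 / π) √f log (4 f / π)`
(`norm_partialSum_le_of_isPrimitive`).

*Imprimitive characters.* Let `f` be the conductor of `χ`. Sifting out a prime divisor of `q` not
dividing `f` doubles the bound for the partial sums. Quadratic reciprocity shows that a prime
dividing `q` exactly once divides `f`, so the squares of the sifted primes divide `q / f`, and the
product of the factors `2` is at most `√(q / f)`. Hence the bound above holds for `χ` with `q` in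
place of `f` (`norm_partialSum_le_of_sq_dvd`, `sq_dvd_of_not_dvd_conductor`).

It remains to check that `log ((2 / π) √q log (4 q / π)) + 1` is below the stated bound for every
`q ≥ 3` (`log_polyaVinogradov_add_one_le`); the moduli `1` and `2` do not occur, because
`χ (-1) = -1`.
-/

/-! ### The value at `1` as an integral of partial sums -/

section AbelSummation

open Filter MeasureTheory Asymptotics
open scoped Topology


/-- Abel summation at `s = 1`: a series `∑ c n / n` with bounded partial sums of `c` converges to
the integral of the partial sums of `c` against `t ^ (-2)`. -/
lemma tendsto_sum_div_of_bounded_partialSum {c : ℕ → ℂ} (hc : c 0 = 0) {B : ℝ}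
    (hB : ∀ n, ‖∑ k ∈ Finset.Icc 1 n, c k‖ ≤ B) :
    Tendsto (fun N : ℕ ↦ ∑ n ∈ Finset.Icc 1 N, c n / n) atTop
      (𝓝 (∫ t in Set.Ioi (1 : ℝ), (∑ k ∈ Finset.Icc 1 ⌊t⌋₊, c k) * (t : ℂ) ^ (-((1 : ℂ) + 1)))) := by
  have h₄ (n : ℕ) : ∑ k ∈ Finset.Icc 0 n, c k = ∑ k ∈ Finset.Icc 1 n, c k := by
    rw [← Finset.insert_Icc_add_one_left_eq_Icc n.zero_le, Finset.sum_insert (by simp), hc,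
      zero_add, zero_add]
  have h₃ (t : ℝ) (ht : t ∈ Set.Ici 1) :
      DifferentiableAt ℝ (fun x : ℝ ↦ (x : ℂ) ^ (-(1 : ℂ))) t :=
    differentiableAt_id.ofReal_cpow_const (zero_lt_one.trans_le ht).ne' (by simp)
  have hO : (fun n : ℕ ↦ ∑ k ∈ Finset.Icc 0 n, c k) =O[atTop] fun n : ℕ ↦ (n : ℝ) ^ (0 : ℝ) := by
    refine IsBigO.of_bound B (Eventually.of_forall fun n ↦ ?_)
    simpa [h₄] using hB n
  have key := tendsto_sum_mul_atTop_nhds_one_sub_integral₀ (𝕜 := ℂ) (c := c)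
    (f := fun x : ℝ ↦ (x : ℂ) ^ (-(1 : ℂ))) (l := 0) (g := fun t ↦ t ^ (-2 : ℝ)) hc h₃ ?_ ?_ ?_
    (integrableAtFilter_rpow_atTop_iff.mpr (by norm_num))
  · convert key using 2
    · rename_i n
      rw [← Finset.insert_Icc_add_one_left_eq_Icc n.zero_le, Finset.sum_insert (by simp), hc]
      simp only [mul_zero, zero_add]
      refine Finset.sum_congr rfl fun k _ ↦ ?_
      rw [Complex.ofReal_natCast, Complex.cpow_neg_one, div_eq_mul_inv, mul_comm]
    · rw [zero_sub, ← integral_neg]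
      refine setIntegral_congr_fun measurableSet_Ioi fun t ht ↦ ?_
      rw [Complex.deriv_ofReal_cpow_const (zero_lt_one.trans ht).ne' (by simp), h₄]
      ring_nf
  · refine (Iff.mpr integrableOn_Ici_iff_integrableOn_Ioi <|
      integrableOn_Ioi_deriv_ofReal_cpow zero_lt_one (by simp)).locallyIntegrableOn
  · have hlim : Tendsto (fun n : ℕ ↦ (n : ℝ) ^ (-(1 : ℝ))) atTop (𝓝 0) :=
      (tendsto_rpow_neg_atTop one_pos).comp tendsto_natCast_atTop_atTop
    refine (IsBigO.mul_atTop_rpow_natCast_of_isBigO_rpow (-1) 0 _ ?_ hO ?_).trans_tendsto hlim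
    · have := (Complex.norm_ofReal_cpow_eventually_eq_atTop (-(1 : ℂ))).isBigO.natCast_atTop
      simpa using isBigO_norm_left.mp this
    · simp
  · refine .mul_atTop_rpow_of_isBigO_rpow (-2) 0 _ ?_ ?_ (by norm_num)
    · have := isBigO_deriv_ofReal_cpow_const_atTop (-(1 : ℂ))
      norm_num at this ⊢
      simpa using this
    · exact (hO.comp_tendsto tendsto_nat_floor_atTop).trans <|
        isEquivalent_nat_floor.isBigO.rpow le_rfl (eventually_ge_atTop 0)

/-- If the partial sums of `χ` are bounded, the integral representation
`L(s, χ) = s ∫ S(t) t ^ (-s - 1)`, valid for `s > 1`, persists at `s = 1`. -/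
lemma LFunction_one_eq_integral {q : ℕ} [NeZero q] {χ : DirichletCharacter ℂ q} (hχ : χ ≠ 1) {B : ℝ}
    (hB : ∀ n : ℕ, ‖∑ k ∈ Finset.Icc 1 n, χ (k : ZMod q)‖ ≤ B) :
    DirichletCharacter.LFunction χ 1 =
      ∫ t in Set.Ioi (1 : ℝ), (∑ k ∈ Finset.Icc 1 ⌊t⌋₊, χ (k : ZMod q)) *
        (t : ℂ) ^ (-((1 : ℂ) + 1)) := by
  have hmeas : Measurable fun t : ℝ ↦ ∑ k ∈ Finset.Icc 1 ⌊t⌋₊, χ (k : ZMod q) :=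
    (measurable_from_nat (f := fun n : ℕ ↦ ∑ k ∈ Finset.Icc 1 n, χ (k : ZMod q))).comp
      Nat.measurable_floor
  have h1 : Tendsto (fun s : ℝ ↦ DirichletCharacter.LFunction χ s) (𝓝[>] 1)
      (𝓝 (DirichletCharacter.LFunction χ 1)) := by
    have hc : Continuous fun s : ℝ ↦ DirichletCharacter.LFunction χ s :=
      (DirichletCharacter.differentiable_LFunction hχ).continuous.comp Complex.continuous_ofReal
    simpa using (hc.tendsto 1).mono_left nhdsWithin_le_nhds
  have h2 : Tendsto (fun s : ℝ ↦ (s : ℂ) * ∫ t in Set.Ioi (1 : ℝ),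
      (∑ k ∈ Finset.Icc 1 ⌊t⌋₊, χ (k : ZMod q)) * (t : ℂ) ^ (-((s : ℂ) + 1))) (𝓝[>] 1)
      (𝓝 (1 * ∫ t in Set.Ioi (1 : ℝ), (∑ k ∈ Finset.Icc 1 ⌊t⌋₊, χ (k : ZMod q)) *
        (t : ℂ) ^ (-((1 : ℂ) + 1)))) := by
    refine Tendsto.mul ?_ ?_
    · have := Complex.continuous_ofReal.tendsto (1 : ℝ)
      simpa using this.mono_left nhdsWithin_le_nhds
    · refine tendsto_integral_filter_of_dominated_convergence (fun t ↦ B * t ^ (-2 : ℝ)) ?_ ?_ ?_ ?_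
      · refine Eventually.of_forall fun s ↦ ?_
        exact (hmeas.mul (by fun_prop)).aestronglyMeasurable
      · filter_upwards [self_mem_nhdsWithin] with s hs
        refine (ae_restrict_iff' measurableSet_Ioi).mpr (Eventually.of_forall fun t ht ↦ ?_)
        have ht' : (1 : ℝ) < t := ht
        have hs' : (1 : ℝ) < s := hs
        rw [norm_mul, Complex.norm_cpow_eq_rpow_re_of_pos (by linarith)]
        refine mul_le_mul (hB _) (Real.rpow_le_rpow_of_exponent_le ht'.le ?_) (by positivity)
          ((norm_nonneg _).trans (hB 0))
        simp; linarith
      · exact (integrableOn_Ioi_rpow_of_lt (by norm_num) one_pos).const_mul B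
      · refine (ae_restrict_iff' measurableSet_Ioi).mpr (Eventually.of_forall fun t ht ↦ ?_)
        have ht' : (t : ℂ) ≠ 0 := by exact_mod_cast (zero_lt_one.trans ht).ne'
        refine Tendsto.const_mul _ ?_
        have hc : Continuous fun s : ℝ ↦ (t : ℂ) ^ (-((s : ℂ) + 1)) :=
          Continuous.const_cpow (by fun_prop) (Or.inl ht')
        simpa using (hc.tendsto 1).mono_left nhdsWithin_le_nhds
  rw [one_mul] at h2
  refine tendsto_nhds_unique h1 (h2.congr' ?_)
  filter_upwards [self_mem_nhdsWithin] with s hs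
  have hs' : (1 : ℝ) < s := hs
  rw [DirichletCharacter.LFunction_eq_LSeries χ (by simpa using hs')]
  refine (LSeries_eq_mul_integral _ le_rfl (by simp; linarith)
    (DirichletCharacter.LSeriesSummable_of_one_lt_re χ (by simpa using hs')) ?_).symm
  refine IsBigO.of_bound B (Eventually.of_forall fun n ↦ ?_)
  simpa using hB n

/-- The integrand `S(t) / t²` is at most `1 / t` for `t ≤ M` and at most `M / t²` beyond, and these
contribute `log M` and `1`. -/
lemma norm_integral_partialSum_le {c : ℕ → ℂ} (hc : ∀ n, ‖c n‖ ≤ 1) {M : ℝ} (hM : 1 ≤ M)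
    (hB : ∀ n, ‖∑ k ∈ Finset.Icc 1 n, c k‖ ≤ M) :
    ‖∫ t in Set.Ioi (1 : ℝ), (∑ k ∈ Finset.Icc 1 ⌊t⌋₊, c k) * (t : ℂ) ^ (-((1 : ℂ) + 1))‖ ≤
      Real.log M + 1 := by
  have hM0 : 0 < M := by linarith
  have hmeas : Measurable fun t : ℝ ↦ ∑ k ∈ Finset.Icc 1 ⌊t⌋₊, c k :=
    (measurable_from_nat (f := fun n ↦ ∑ k ∈ Finset.Icc 1 n, c k)).comp Nat.measurable_floor
  have hn {t : ℝ} (ht : 0 < t) : ‖(t : ℂ) ^ (-((1 : ℂ) + 1))‖ = t ^ (-2 : ℝ) := by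
    rw [Complex.norm_cpow_eq_rpow_re_of_pos ht]; norm_num
  have hlarge : ∀ t : ℝ, 0 < t → ‖(∑ k ∈ Finset.Icc 1 ⌊t⌋₊, c k) * (t : ℂ) ^ (-((1 : ℂ) + 1))‖ ≤
      M * t ^ (-2 : ℝ) := fun t ht ↦ by
    rw [norm_mul, hn ht]
    exact mul_le_mul_of_nonneg_right (hB _) (by positivity)
  have hsmall : ∀ t : ℝ, 0 < t → ‖(∑ k ∈ Finset.Icc 1 ⌊t⌋₊, c k) * (t : ℂ) ^ (-((1 : ℂ) + 1))‖ ≤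
      t⁻¹ := fun t ht ↦ by
    have h1 : ‖∑ k ∈ Finset.Icc 1 ⌊t⌋₊, c k‖ ≤ t := by
      refine (norm_sum_le_of_le _ fun k _ ↦ hc k).trans ?_
      simpa using Nat.floor_le ht.le
    rw [norm_mul, hn ht]
    refine (mul_le_mul_of_nonneg_right h1 (by positivity)).trans_eq ?_
    rw [show (-2 : ℝ) = -1 - 1 by norm_num, Real.rpow_sub_one ht.ne', Real.rpow_neg_one]
    field_simp
  have hi1 : IntegrableOn (fun t : ℝ ↦ M * t ^ (-2 : ℝ)) (Set.Ioi 1) :=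
    (integrableOn_Ioi_rpow_of_lt (by norm_num) one_pos).const_mul M
  have hint : IntegrableOn (fun t : ℝ ↦ (∑ k ∈ Finset.Icc 1 ⌊t⌋₊, c k) *
      (t : ℂ) ^ (-((1 : ℂ) + 1))) (Set.Ioi 1) := by
    refine hi1.mono' (hmeas.mul (by fun_prop)).aestronglyMeasurable ?_
    exact (ae_restrict_iff' measurableSet_Ioi).mpr
      (Eventually.of_forall fun t ht ↦ hlarge t (zero_lt_one.trans ht))
  have hinv : IntervalIntegrable (fun t : ℝ ↦ t⁻¹) volume 1 M :=
    intervalIntegral.intervalIntegrable_inv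
      (fun t ht ↦ by rw [Set.uIcc_of_le hM] at ht; linarith [ht.1]) continuousOn_id
  rw [← Set.Ioc_union_Ioi_eq_Ioi hM, setIntegral_union Set.Ioc_disjoint_Ioi_same measurableSet_Ioi
    (hint.mono_set Set.Ioc_subset_Ioi_self) (hint.mono_set (Set.Ioi_subset_Ioi hM))]
  refine (norm_add_le _ _).trans (add_le_add ?_ ?_)
  · calc _ ≤ ∫ t in Set.Ioc 1 M, t⁻¹ := by
          refine norm_integral_le_of_norm_le
            ((intervalIntegrable_iff_integrableOn_Ioc_of_le hM).mp hinv) ?_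
          exact (ae_restrict_iff' measurableSet_Ioc).mpr
            (Eventually.of_forall fun t ht ↦ hsmall t (zero_lt_one.trans ht.1))
      _ = Real.log M := by
          rw [← intervalIntegral.integral_of_le hM, integral_inv_of_pos one_pos hM0, div_one]
  · calc _ ≤ ∫ t in Set.Ioi M, M * t ^ (-2 : ℝ) := by
          refine norm_integral_le_of_norm_le (hi1.mono_set (Set.Ioi_subset_Ioi hM)) ?_
          exact (ae_restrict_iff' measurableSet_Ioi).mpr
            (Eventually.of_forall fun t ht ↦ hlarge t (hM0.trans ht))
      _ = 1 := by
          rw [integral_const_mul, integral_Ioi_rpow_of_lt (by norm_num) hM0]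
          norm_num [Real.rpow_neg_one, hM0.ne']

end AbelSummation

/-! ### The Pólya–Vinogradov inequality for primitive characters -/

section PolyaVinogradov

open Finset

/-- Midpoint convexity of `1 / sin`, integrated: the integral of `1 / sin` over an interval of
length `2h` centred at `x` is at least `2h / sin x`. -/
lemma two_mul_div_sin_le_log_tan {x h : ℝ} (hh : 0 ≤ h) (hx : h < x) (hx' : x + h < Real.pi) :
    2 * h / Real.sin x ≤
      Real.log (Real.tan ((x + h) / 2)) - Real.log (Real.tan ((x - h) / 2)) := by
  have hd (y : ℝ) (hy : 0 < y) (hy' : y < Real.pi) :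
      HasDerivAt (fun z ↦ Real.log (Real.tan (z / 2))) (1 / Real.sin y) y := by
    have hc : 0 < Real.cos (y / 2) := Real.cos_pos_of_mem_Ioo ⟨by linarith, by linarith⟩
    have hs : 0 < Real.sin (y / 2) := Real.sin_pos_of_pos_of_lt_pi (by linarith) (by linarith)
    have h1 := ((Real.hasDerivAt_tan hc.ne').comp y ((hasDerivAt_id y).div_const 2)).log
      (by simp only [Function.comp, id, Real.tan_eq_sin_div_cos]; positivity)
    refine h1.congr_deriv ?_
    change 1 / Real.cos (y / 2) ^ 2 * (1 / 2) / Real.tan (y / 2) = _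
    simp only [Real.tan_eq_sin_div_cos]
    rw [show y = 2 * (y / 2) by ring, Real.sin_two_mul]
    rw [show 2 * (y / 2) / 2 = y / 2 by ring]
    field_simp
  have hx0 : 0 < x := by linarith
  have hsx : 0 < Real.sin x := Real.sin_pos_of_pos_of_lt_pi hx0 (by linarith)
  let g : ℝ → ℝ := fun k ↦ Real.log (Real.tan ((x + k) / 2)) - Real.log (Real.tan ((x - k) / 2)) -
    2 * k / Real.sin x
  have hg (k : ℝ) (hk : k ∈ Set.Icc 0 h) : HasDerivAt g
      (1 / Real.sin (x + k) + 1 / Real.sin (x - k) - 2 / Real.sin x) k := by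
    have h1 := (hd (x + k) (by linarith [hk.1]) (by linarith [hk.2])).comp k
      ((hasDerivAt_id k).const_add x)
    have h2 := (hd (x - k) (by linarith [hk.2]) (by linarith [hk.1])).comp k
      ((hasDerivAt_id k).const_sub x)
    have h3 := ((hasDerivAt_id k).const_mul 2).div_const (Real.sin x)
    refine ((h1.sub h2).sub h3).congr_deriv ?_
    ring
  have hmono : MonotoneOn g (Set.Icc 0 h) := by
    refine monotoneOn_of_deriv_nonneg (convex_Icc 0 h)
      (fun k hk ↦ (hg k hk).continuousAt.continuousWithinAt)
      (fun k hk ↦ (hg k (interior_subset hk)).differentiableAt.differentiableWithinAt) ?_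
    intro k hk
    have hk := interior_subset hk
    rw [(hg k hk).deriv, sub_nonneg]
    have hp : 0 < Real.sin (x + k) :=
      Real.sin_pos_of_pos_of_lt_pi (by linarith [hk.1]) (by linarith [hk.2])
    have hm : 0 < Real.sin (x - k) :=
      Real.sin_pos_of_pos_of_lt_pi (by linarith [hk.2]) (by linarith [hk.1])
    have hck : 0 ≤ Real.cos k :=
      Real.cos_nonneg_of_mem_Icc ⟨by linarith [hk.1, Real.pi_pos], by linarith [hk.2]⟩
    have hsum : Real.sin (x + k) + Real.sin (x - k) = 2 * Real.sin x * Real.cos k := by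
      rw [Real.sin_add, Real.sin_sub]; ring
    have hprod : Real.sin (x + k) * Real.sin (x - k) = Real.sin x ^ 2 - Real.sin k ^ 2 := by
      rw [Real.sin_add, Real.sin_sub]
      linear_combination Real.sin x ^ 2 * Real.sin_sq_add_cos_sq k -
        Real.sin k ^ 2 * Real.sin_sq_add_cos_sq x
    have hk1 := Real.sin_sq_add_cos_sq k
    have hx1 : Real.sin x ^ 2 ≤ 1 := Real.sin_sq_le_one x
    have hck1 := Real.cos_le_one k
    rw [div_add_div _ _ hp.ne' hm.ne', div_le_div_iff₀ hsx (mul_pos hp hm), hprod]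
    rw [show 1 * Real.sin (x - k) + Real.sin (x + k) * 1 = 2 * Real.sin x * Real.cos k by
      rw [← hsum]; ring]
    -- the claim is `sin² x (1 - cos k) ≤ sin² k = (1 - cos k) (1 + cos k)`
    nlinarith [mul_nonneg (sub_nonneg.2 hck1) hck, mul_nonneg (sub_nonneg.2 hck1) (sub_nonneg.2 hx1)]
  have := hmono ⟨le_rfl, hh⟩ ⟨hh, le_rfl⟩ hh
  simp only [g, add_zero, sub_zero, sub_self, mul_zero, zero_div] at this
  linarith

/-- The residue `0` contributes `0⁻¹ = 0` to the left-hand side. -/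
lemma sum_inv_sin_le {f : ℕ} [NeZero f] :
    ∑ a : ZMod f, (Real.sin (Real.pi * a.val / f))⁻¹ ≤
      2 * f / Real.pi * Real.log (4 * f / Real.pi) := by
  have hpi := Real.pi_pos
  have hf0 : (0 : ℝ) < f := by exact_mod_cast NeZero.pos f
  have hrange : ∑ a : ZMod f, (Real.sin (Real.pi * a.val / f))⁻¹ =
      ∑ a ∈ range (f - 1), (Real.sin (Real.pi * (a + 1 : ℕ) / f))⁻¹ := by
    obtain ⟨k, rfl⟩ := Nat.exists_eq_succ_of_ne_zero (NeZero.ne f)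
    have := Fin.sum_univ_eq_sum_range
      (fun a : ℕ ↦ (Real.sin (Real.pi * a / (k.succ : ℕ)))⁻¹) k.succ
    refine this.trans ?_
    rw [sum_range_succ']
    simp
  let T : ℕ → ℝ := fun a ↦ Real.log (Real.tan ((2 * a + 1) * Real.pi / (4 * f)))
  have hterm : ∀ a ∈ range (f - 1), (Real.sin (Real.pi * (a + 1 : ℕ) / f))⁻¹ ≤
      f / Real.pi * (T (a + 1) - T a) := by
    intro a ha
    have ha1 : (a : ℝ) + 1 + 1 ≤ f := by
      have := mem_range.1 ha
      have : a + 1 + 1 ≤ f := by omega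
      exact_mod_cast this
    have key := two_mul_div_sin_le_log_tan (x := Real.pi * (a + 1 : ℕ) / f)
      (h := Real.pi / (2 * f)) (by positivity) ?_ ?_
    · have e1 : (Real.pi * (a + 1 : ℕ) / f + Real.pi / (2 * f)) / 2 =
          (2 * (a + 1 : ℕ) + 1) * Real.pi / (4 * f) := by
        field_simp; ring
      have e2 : (Real.pi * (a + 1 : ℕ) / f - Real.pi / (2 * f)) / 2 =
          (2 * a + 1) * Real.pi / (4 * f) := by
        push_cast; field_simp; ring
      rw [e1, e2] at key
      have : (Real.sin (Real.pi * (a + 1 : ℕ) / f))⁻¹ =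
          f / Real.pi * (2 * (Real.pi / (2 * f)) / Real.sin (Real.pi * (a + 1 : ℕ) / f)) := by
        field_simp
      rw [this]
      exact mul_le_mul_of_nonneg_left key (by positivity)
    · rw [div_lt_div_iff₀ (by positivity) hf0]
      push_cast
      nlinarith [mul_pos hpi hf0, (Nat.cast_nonneg a : (0 : ℝ) ≤ a),
        mul_nonneg (mul_pos hpi hf0).le (Nat.cast_nonneg a : (0 : ℝ) ≤ a)]
    · rw [div_add_div _ _ hf0.ne' (by positivity), div_lt_iff₀ (by positivity)]
      push_cast
      nlinarith [mul_pos hpi hf0, mul_le_mul_of_nonneg_left ha1 (mul_pos hpi hf0).le]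
  rw [hrange]
  refine (sum_le_sum hterm).trans ?_
  rw [← mul_sum, sum_range_sub]
  have hpos : 0 < Real.pi / (4 * f) := by positivity
  have hf1 : (1 : ℝ) ≤ f := by exact_mod_cast NeZero.one_le
  have hlt : Real.pi / (4 * f) < Real.pi / 2 := by
    rw [div_lt_div_iff₀ (by positivity) (by norm_num)]; nlinarith
  have hT0 : Real.log (Real.pi / (4 * f)) ≤ T 0 := by
    simp only [T, Nat.cast_zero, mul_zero, zero_add, one_mul]
    exact Real.log_le_log hpos (Real.le_tan hpos.le hlt)
  have hT1 : T (f - 1) = -T 0 := by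
    simp only [T, Nat.cast_zero, mul_zero, zero_add, one_mul]
    rw [Nat.cast_sub NeZero.one_le, ← Real.log_inv, ← Real.tan_pi_div_two_sub]
    congr 2
    field_simp; push_cast; ring
  have hlog : Real.log (4 * f / Real.pi) = -Real.log (Real.pi / (4 * f)) := by
    rw [← Real.log_inv, inv_div]
  rw [hT1, hlog]
  calc _ = 2 * f / Real.pi * (-T 0) := by ring
    _ ≤ _ := mul_le_mul_of_nonneg_left (by linarith) (by positivity)

open ZMod DirichletCharacter

lemma norm_gaussSum_stdAddChar {f : ℕ} [NeZero f] {ψ : DirichletCharacter ℂ f}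
    (hψ : ψ.IsPrimitive) : ‖gaussSum ψ stdAddChar‖ = √f := by
  have hone (φ : DirichletCharacter ℂ f) : ‖φ (-1)‖ = 1 := by
    rcases φ.even_or_odd with h | h <;> rw [h] <;> simp
  have h1 := congrFun (dft_dft (ψ : ZMod f → ℂ)) 1
  have h2 : 𝓕 (ψ : ZMod f → ℂ) =
      fun k ↦ ψ⁻¹ (-1) * gaussSum ψ stdAddChar * ψ⁻¹ k := by
    ext k
    rw [hψ.fourierTransform_eq_inv_mul_gaussSum, neg_eq_neg_one_mul k, map_mul]
    ring
  have hinv : (stdAddChar (N := f))⁻¹ = stdAddChar.mulShift (-1) :=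
    AddChar.inv_mulShift _
  rw [h2, dft_const_mul] at h1
  beta_reduce at h1
  rw [fourierTransform_eq_gaussSum_mulShift, ← hinv,
    ← star_gaussSum_eq] at h1
  have h3 := congrArg norm h1
  simp only [norm_mul, smul_eq_mul, hone, norm_star, Complex.norm_natCast, one_mul, mul_one] at h3
  rw [← h3, Real.sqrt_mul_self (norm_nonneg _)]

lemma norm_geom_stdAddChar_le {f : ℕ} [NeZero f] {a : ZMod f} (ha : a ≠ 0) (N : ℕ) :
    ‖∑ n ∈ Icc 1 N, stdAddChar (a * (n : ZMod f))‖ ≤ (Real.sin (Real.pi * a.val / f))⁻¹ := by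
  have hf0 : (0 : ℝ) < f := by exact_mod_cast NeZero.pos f
  have hv : 0 < a.val := Nat.pos_of_ne_zero fun h ↦ ha ((ZMod.val_eq_zero a).1 h)
  have hv' : (a.val : ℝ) < f := by exact_mod_cast a.val_lt
  have hsin : 0 < Real.sin (Real.pi * a.val / f) := by
    apply Real.sin_pos_of_pos_of_lt_pi
    · have : (0 : ℝ) < a.val := by exact_mod_cast hv
      positivity
    · rw [div_lt_iff₀ hf0]; exact mul_lt_mul_of_pos_left hv' Real.pi_pos
  set z : ℂ := stdAddChar a with hz
  have hz1 : ‖z‖ = 1 := by rw [hz, stdAddChar_apply, Circle.norm_coe]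
  have hzn : ‖z - 1‖ = 2 * Real.sin (Real.pi * a.val / f) := by
    have h1 : z = Complex.exp (Complex.I * (2 * (Real.pi * a.val / f) : ℝ)) := by
      have := stdAddChar_coe (N := f) (a.val : ℤ)
      rw [Int.cast_natCast, ZMod.natCast_zmod_val] at this
      rw [hz, this]
      congr 1; push_cast; ring
    rw [h1, Complex.norm_exp_I_mul_ofReal_sub_one, Real.norm_eq_abs,
      mul_div_cancel_left₀ _ (two_ne_zero), abs_of_pos (by positivity)]
  have hsum : (z - 1) * ∑ n ∈ Icc 1 N, stdAddChar (a * (n : ZMod f)) = z * (z ^ N - 1) := by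
    have : ∑ n ∈ Icc 1 N, stdAddChar (a * (n : ZMod f)) = z * ∑ n ∈ range N, z ^ n := by
      induction N with
      | zero => simp
      | succ N ih =>
        rw [sum_Icc_succ_top (by omega), ih, sum_range_succ, mul_add, ← pow_succ', mul_comm a,
          ← nsmul_eq_mul, AddChar.map_nsmul_eq_pow]
    rw [this, mul_left_comm, mul_geom_sum]
  have hn := congrArg norm hsum
  rw [norm_mul, norm_mul, hzn, hz1, one_mul] at hn
  have h2 : ‖z ^ N - 1‖ ≤ 2 := by
    refine (norm_sub_le _ _).trans ?_
    rw [norm_pow, hz1]; norm_num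
  rw [← one_div, le_div_iff₀ hsin]
  nlinarith

/-- The Pólya–Vinogradov inequality: the finite Fourier expansion of `ψ` turns its partial sum into
a combination of geometric sums, with coefficients of modulus at most `f ^ (-1/2)`. -/
lemma norm_partialSum_le_of_isPrimitive {f : ℕ} [NeZero f] (hf : f ≠ 1)
    {ψ : DirichletCharacter ℂ f} (hψ : ψ.IsPrimitive) (N : ℕ) :
    ‖∑ n ∈ Icc 1 N, ψ (n : ZMod f)‖ ≤ 2 / Real.pi * √f * Real.log (4 * f / Real.pi) := by
  have hf0 : (0 : ℝ) < f := by exact_mod_cast NeZero.pos f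
  have hexp (n : ZMod f) : (f : ℂ) * ψ n =
      gaussSum ψ stdAddChar * ∑ k : ZMod f, ψ⁻¹ (-k) * stdAddChar (k * n) := by
    have h := congrFun (dft_dft (ψ : ZMod f → ℂ)) (-n)
    rw [neg_neg, smul_eq_mul] at h
    rw [← h, dft_apply, mul_sum]
    refine sum_congr rfl fun k _ ↦ ?_
    rw [hψ.fourierTransform_eq_inv_mul_gaussSum, smul_eq_mul, mul_neg, neg_neg]
    ring
  have hsum : (f : ℂ) * ∑ n ∈ Icc 1 N, ψ (n : ZMod f) = gaussSum ψ stdAddChar *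
      ∑ k : ZMod f, ψ⁻¹ (-k) * ∑ n ∈ Icc 1 N, stdAddChar (k * (n : ZMod f)) := by
    rw [mul_sum]
    simp_rw [hexp, ← mul_sum]
    rw [sum_comm]
    simp_rw [mul_sum]
  have hbound : ‖∑ k : ZMod f, ψ⁻¹ (-k) * ∑ n ∈ Icc 1 N, stdAddChar (k * (n : ZMod f))‖ ≤
      2 * f / Real.pi * Real.log (4 * f / Real.pi) := by
    refine (norm_sum_le_of_le _ fun k _ ↦ ?_).trans sum_inv_sin_le
    rcases eq_or_ne k 0 with rfl | hk
    · simp [ψ⁻¹.map_zero' hf]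
    · rw [norm_mul]
      exact (mul_le_of_le_one_left (norm_nonneg _) (DirichletCharacter.norm_le_one _ _)).trans
        (norm_geom_stdAddChar_le hk N)
  have hn := congrArg norm hsum
  rw [norm_mul, norm_mul, Complex.norm_natCast, norm_gaussSum_stdAddChar hψ] at hn
  refine le_of_mul_le_mul_left ?_ hf0
  rw [hn]
  refine (mul_le_mul_of_nonneg_left hbound (Real.sqrt_nonneg _)).trans_eq ?_
  ring

end PolyaVinogradov

/-! ### Imprimitive characters -/

section Sieve

open Finset

/-- Removing the multiples of the primes in `T` one prime at a time at most doubles the bound each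
time, since the multiples of `p` up to `N` carry `ψ p` times the partial sum up to `N / p`. -/
lemma norm_sifted_partialSum_le {f : ℕ} (ψ : DirichletCharacter ℂ f) {M : ℝ}
    (hM : ∀ N : ℕ, ‖∑ n ∈ Icc 1 N, ψ (n : ZMod f)‖ ≤ M) (T : Finset ℕ) (hT : ∀ p ∈ T, p.Prime)
    (N : ℕ) : ‖∑ n ∈ Icc 1 N with ∀ p ∈ T, ¬ p ∣ n, ψ (n : ZMod f)‖ ≤ 2 ^ #T * M := by
  classical
  induction T using Finset.induction_on generalizing N with
  | empty => simpa using hM N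
  | insert p T hp ih =>
    have ih := ih fun r hr ↦ hT r (mem_insert_of_mem hr)
    have hpp : p.Prime := hT p (mem_insert_self p T)
    have hsplit : ∑ n ∈ Icc 1 N with ∀ r ∈ insert p T, ¬ r ∣ n, ψ (n : ZMod f) =
        ∑ n ∈ Icc 1 N with ∀ r ∈ T, ¬ r ∣ n, ψ (n : ZMod f) -
          ∑ n ∈ (Icc 1 N).filter (fun n ↦ ∀ r ∈ T, ¬ r ∣ n) with p ∣ n, ψ (n : ZMod f) := by
      rw [eq_sub_iff_add_eq, add_comm, ← sum_filter_add_sum_filter_not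
        ((Icc 1 N).filter (fun n ↦ ∀ r ∈ T, ¬ r ∣ n)) (fun n ↦ p ∣ n)]
      congr 2
      ext n
      simp only [mem_filter, forall_mem_insert]
      tauto
    have hmul : ∑ n ∈ (Icc 1 N).filter (fun n ↦ ∀ r ∈ T, ¬ r ∣ n) with p ∣ n, ψ (n : ZMod f) =
        ψ (p : ZMod f) * ∑ n ∈ Icc 1 (N / p) with ∀ r ∈ T, ¬ r ∣ n, ψ (n : ZMod f) := by
      rw [mul_sum]
      refine sum_nbij' (fun n ↦ n / p) (fun m ↦ p * m) ?_ ?_ ?_ ?_ ?_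
      · intro n hn
        simp only [mem_filter, mem_Icc] at hn ⊢
        obtain ⟨⟨⟨h1, h2⟩, h3⟩, m, rfl⟩ := hn
        rw [Nat.mul_div_cancel_left m hpp.pos]
        exact ⟨⟨Nat.pos_of_ne_zero (by rintro rfl; simp at h1),
          (Nat.le_div_iff_mul_le hpp.pos).2 (by rwa [mul_comm])⟩,
          fun r hr hrm ↦ h3 r hr (hrm.mul_left p)⟩
      · intro m hm
        simp only [mem_filter, mem_Icc] at hm ⊢
        obtain ⟨⟨h1, h2⟩, h3⟩ := hm
        refine ⟨⟨⟨Nat.mul_pos hpp.pos h1, ?_⟩, ?_⟩, dvd_mul_right p m⟩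
        · rw [mul_comm]; exact (Nat.le_div_iff_mul_le hpp.pos).1 h2
        · intro r hr hrm
          have hrp := hT r (mem_insert_of_mem hr)
          rcases hrp.dvd_mul.1 hrm with h | h
          · exact hp ((Nat.prime_dvd_prime_iff_eq hrp hpp).1 h ▸ hr)
          · exact h3 r hr h
      · intro n hn
        exact Nat.mul_div_cancel' (mem_filter.1 hn).2
      · intro m _
        exact Nat.mul_div_cancel_left m hpp.pos
      · intro n hn
        rw [← map_mul, ← Nat.cast_mul, Nat.mul_div_cancel' (mem_filter.1 hn).2]
    rw [hsplit, hmul, card_insert_of_notMem hp, pow_succ]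
    refine (norm_sub_le _ _).trans ?_
    rw [norm_mul]
    have h1 := ih N
    have h2 := (mul_le_of_le_one_left (norm_nonneg _)
      (DirichletCharacter.norm_le_one ψ (p : ZMod f))).trans (ih (N / p))
    linarith

/-- If the square of every prime divisor of `q` prime to the conductor divides `q`, then `χ` obeys
the Pólya–Vinogradov bound of a primitive character modulo `q`: the sieve factor `2 ^ #T` is
absorbed by `√(q / f) ≥ ∏ p ∈ T, p`. -/
lemma norm_partialSum_le_of_sq_dvd {q : ℕ} [NeZero q] {χ : DirichletCharacter ℂ q} (hχ : χ ≠ 1)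
    (hsq : ∀ p : ℕ, p.Prime → p ∣ q → ¬ p ∣ χ.conductor → p ^ 2 ∣ q) (N : ℕ) :
    ‖∑ n ∈ Icc 1 N, χ (n : ZMod q)‖ ≤ 2 / Real.pi * √q * Real.log (4 * q / Real.pi) := by
  classical
  set f := χ.conductor with hf
  have : NeZero f := ⟨χ.conductor_ne_zero⟩
  have hfq : f ∣ q := χ.conductor_dvd_level
  have hf1 : f ≠ 1 := fun h ↦ hχ (χ.eq_one_iff_conductor_eq_one.2 h)
  set ψ := χ.primitiveCharacter
  set T := q.primeFactors.filter (fun p ↦ ¬ p ∣ f) with hTdef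
  have hT : ∀ p ∈ T, p.Prime ∧ p ∣ q ∧ ¬ p ∣ f := fun p hp ↦ by
    simp only [hTdef, mem_filter, Nat.mem_primeFactors] at hp
    exact ⟨hp.1.1, hp.1.2.1, hp.2⟩
  have hsift : ∑ n ∈ Icc 1 N, χ (n : ZMod q) =
      ∑ n ∈ Icc 1 N with ∀ p ∈ T, ¬ p ∣ n, ψ (n : ZMod f) := by
    rw [sum_filter]
    refine sum_congr rfl fun n _ ↦ ?_
    by_cases hn : n.Coprime q
    · rw [if_pos]
      · have := χ.primitiveCharacter_apply_of_isCoprime (a := n) (Nat.isCoprime_iff_coprime.2 hn)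
        simpa using this.symm
      · exact fun p hp hpn ↦ Nat.not_coprime_of_dvd_of_dvd (hT p hp).1.one_lt hpn (hT p hp).2.1 hn
    · have h0 : χ (n : ZMod q) = 0 :=
        χ.map_nonunit fun h ↦ hn ((ZMod.isUnit_iff_coprime n q).1 h)
      rw [h0]
      split_ifs with hdiv
      · obtain ⟨p, hp, hpn, hpq⟩ := Nat.Prime.not_coprime_iff_dvd.1 hn
        have hpf : p ∣ f := by
          by_contra hpf
          exact hdiv p (by simp [hTdef, hp, hpq, hpf, NeZero.ne q]) hpn
        refine (ψ.map_nonunit fun h ↦ ?_).symm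
        exact Nat.not_coprime_of_dvd_of_dvd hp.one_lt hpn hpf ((ZMod.isUnit_iff_coprime n f).1 h)
      · rfl
  have hprod : (∏ p ∈ T, p ^ 2) * f ∣ q := by
    refine Nat.Coprime.mul_dvd_of_dvd_of_dvd ?_ ?_ hfq
    · refine Nat.Coprime.prod_left fun p hp ↦ Nat.Coprime.pow_left 2 ?_
      exact (hT p hp).1.coprime_iff_not_dvd.2 (hT p hp).2.2
    · refine prod_dvd_of_isRelPrime ?_ fun p hp ↦ hsq p (hT p hp).1 (hT p hp).2.1 (hT p hp).2.2
      intro p hp r hr hpr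
      rw [Function.onFun, ← Nat.coprime_iff_isRelPrime]
      exact Nat.Coprime.pow 2 2 ((Nat.coprime_primes (hT p hp).1 (hT r hr).1).2 hpr)
  have hcard : (2 ^ #T) ^ 2 * f ≤ q := by
    refine le_trans ?_ (Nat.le_of_dvd (NeZero.pos q) hprod)
    refine Nat.mul_le_mul_right f ?_
    rw [← pow_mul, mul_comm, pow_mul, ← prod_const]
    exact prod_le_prod' fun p hp ↦ Nat.pow_le_pow_left (hT p hp).1.two_le 2
  have hf0 : (0 : ℝ) < f := by exact_mod_cast NeZero.pos f
  have hpi := Real.pi_pos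
  have hsqrt : 2 ^ #T * √f ≤ √q := by
    refine Real.le_sqrt_of_sq_le ?_
    rw [mul_pow, Real.sq_sqrt hf0.le]
    exact_mod_cast hcard
  have hfq' : (f : ℝ) ≤ q := by exact_mod_cast Nat.le_of_dvd (NeZero.pos q) hfq
  have hlog : Real.log (4 * f / Real.pi) ≤ Real.log (4 * q / Real.pi) :=
    Real.log_le_log (by positivity) (by gcongr)
  have hlog0 : 0 ≤ Real.log (4 * f / Real.pi) := by
    refine Real.log_nonneg ((one_le_div hpi).2 ?_)
    have : (1 : ℝ) ≤ f := by exact_mod_cast NeZero.one_le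
    linarith [Real.pi_le_four]
  rw [hsift]
  refine (norm_sifted_partialSum_le ψ (norm_partialSum_le_of_isPrimitive hf1
    χ.primitiveCharacter_isPrimitive) T (fun p hp ↦ (hT p hp).1) N).trans ?_
  calc _ = 2 / Real.pi * (2 ^ #T * √f) * Real.log (4 * f / Real.pi) := by ring
    _ ≤ _ := by gcongr

end Sieve

/-! ### The Kronecker symbol at primes exactly dividing `d` -/

lemma kroneckerSymbol_neg_one_right {d : ℤ} (hd : d < 0) : kroneckerSymbol d (-1) = -1 := by
  simp [kroneckerSymbol, hd]

lemma kroneckerSymbol_natCast_of_odd (d : ℤ) {n : ℕ} (hn : Odd n) :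
    kroneckerSymbol d n = jacobiSym d n := by
  have h2 : n.factorization 2 = 0 :=
    Nat.factorization_eq_zero_of_not_dvd fun h ↦ (Nat.not_even_iff_odd.2 hn) (even_iff_two_dvd.2 h)
  have hn0 : n ≠ 0 := by rintro rfl; simp at hn
  simp [kroneckerSymbol, h2, hn0]

/-- The congruence conditions make every Jacobi symbol `(e / n)` with `|e| = m` equal to `1`. -/
lemma exists_jacobiSym_eq_neg_one_of_coprime {p m : ℕ} (hp : p.Prime) (hpm : p.Coprime m) :
    ∃ n : ℕ, n % 4 = 1 ∧ n ≡ 1 [MOD 4 * m] ∧ jacobiSym p n = -1 := by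
  rcases hp.eq_two_or_odd' with rfl | hodd
  · -- here `m` is odd, and `(2 / n) = -1` for `n ≡ 5` mod `8`
    obtain ⟨n, h8, hm⟩ := Nat.chineseRemainder (n := 8) (m := m)
      (Nat.Coprime.pow_left 3 hpm) 5 1
    have h4 : n ≡ 1 [MOD 4] := (h8.of_dvd (by norm_num : 4 ∣ 8)).trans (by decide)
    have hn4 : n % 4 = 1 := h4
    refine ⟨n, hn4, (Nat.modEq_and_modEq_iff_modEq_mul (Nat.Coprime.pow_left 2 hpm)).1 ⟨h4, hm⟩, ?_⟩
    have hn8 : n % 8 = 5 := h8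
    rw [Nat.cast_ofNat, jacobiSym.at_two (Nat.odd_iff.2 (by omega)), ZMod.χ₈_nat_eq_if_mod_eight]
    simp [hn8, show n % 2 = 1 by omega]
  · have : Fact p.Prime := ⟨hp⟩
    obtain ⟨a, ha⟩ := FiniteField.exists_nonsquare (F := ZMod p)
      (by rw [ZMod.ringChar_zmod_n]; rintro rfl; exact absurd hodd (by decide))
    have hcop : p.Coprime (4 * m) :=
      Nat.Coprime.mul_right ((Nat.coprime_pow_right_iff two_pos p 2).2 hodd.coprime_two_right) hpm
    obtain ⟨n, hnp, hm⟩ := Nat.chineseRemainder hcop a.val 1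
    have hn4 : n % 4 = 1 := hm.of_dvd (dvd_mul_right 4 m)
    refine ⟨n, hn4, hm, ?_⟩
    rw [jacobiSym.quadratic_reciprocity_one_mod_four' hodd hn4,
      ZMod.nonsquare_iff_jacobiSym_eq_neg_one, Int.cast_natCast,
      (ZMod.natCast_eq_natCast_iff n a.val p).2 hnp, ZMod.natCast_zmod_val]
    exact ha

/-- Write `d = p * e`. By reciprocity `n ≡ 1` modulo `4 |e|` forces `(e / n) = 1`, while `(p / n)`
can still be `-1`. -/
lemma exists_kroneckerSymbol_eq_neg_one {d : ℤ} {p : ℕ} (hp : p.Prime)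
    (hpd : p ∣ d.natAbs) (hpd2 : ¬ p ^ 2 ∣ d.natAbs) :
    ∃ n : ℕ, n ≡ 1 [MOD d.natAbs / p] ∧ kroneckerSymbol d n = -1 := by
  obtain ⟨e, rfl⟩ := Int.natCast_dvd.2 hpd
  have hpe : p.Coprime e.natAbs := by
    refine (hp.coprime_iff_not_dvd).2 fun h ↦ hpd2 ?_
    rw [Int.natAbs_mul, Int.natAbs_natCast, sq]
    exact Nat.mul_dvd_mul_left p h
  obtain ⟨n, hn4, hn, hpn⟩ := exists_jacobiSym_eq_neg_one_of_coprime hp hpe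
  have hodd : Odd n := Nat.odd_iff.2 (by omega)
  refine ⟨n, ?_, ?_⟩
  · rw [Int.natAbs_mul, Int.natAbs_natCast, Nat.mul_div_cancel_left _ hp.pos]
    exact hn.of_dvd (dvd_mul_left _ 4)
  · rw [kroneckerSymbol_natCast_of_odd _ hodd, jacobiSym.mul_left, hpn, jacobiSym.mod_right e hodd,
      show n % (4 * e.natAbs) = 1 % (4 * e.natAbs) from hn,
      ← jacobiSym.mod_right e odd_one, jacobiSym.one_right]
    rfl

/-- If `p` divides `d` exactly once, `χ` takes the value `-1` at some `n ≡ 1` modulo `|d| / p`, so its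
conductor does not divide `|d| / p` and is therefore divisible by `p`. -/
lemma sq_dvd_of_not_dvd_conductor {d : ℤ} [NeZero d.natAbs] {χ : DirichletCharacter ℂ d.natAbs}
    (hχ : ∀ m : ℤ, χ (m : ZMod d.natAbs) = (kroneckerSymbol d m : ℂ)) {p : ℕ} (hp : p.Prime)
    (hpd : p ∣ d.natAbs) (hpf : ¬ p ∣ χ.conductor) : p ^ 2 ∣ d.natAbs := by
  by_contra hpd2
  obtain ⟨n, hn, hkn⟩ := exists_kroneckerSymbol_eq_neg_one hp hpd hpd2
  have hχn : χ ((n : ℤ) : ZMod d.natAbs) = -1 := by rw [hχ, hkn]; simp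
  have hdvd : χ.conductor ∣ d.natAbs / p := by
    refine (Nat.Coprime.dvd_of_dvd_mul_left ((hp.coprime_iff_not_dvd).2 hpf).symm ?_)
    rw [Nat.mul_div_cancel' hpd]
    exact χ.conductor_dvd_level
  have hψ := χ.primitiveCharacter_apply_of_isCoprime (a := n)
    ((χ.apply_ne_zero_iff n).1 (by rw [hχn]; simp))
  rw [hχn, Int.cast_natCast, (ZMod.natCast_eq_natCast_iff n 1 _).2 (hn.of_dvd hdvd), Nat.cast_one,
    map_one] at hψ
  norm_num at hψ

/-! ### The numerical comparison -/

lemma one_le_polyaVinogradov {x : ℝ} (hx : 3 ≤ x) :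
    1 ≤ 2 / Real.pi * √x * Real.log (4 * x / Real.pi) := by
  have hpi := Real.pi_pos
  have hpi' := Real.pi_lt_d2
  have h1 : 1 ≤ Real.log (4 * x / Real.pi) := by
    rw [Real.le_log_iff_exp_le (by positivity), le_div_iff₀ hpi]
    nlinarith [Real.exp_one_lt_d9, Real.exp_pos 1]
  have h2 : (1.7 : ℝ) ≤ √x := Real.le_sqrt_of_sq_le (by norm_num; linarith)
  have h3 : 1 ≤ 2 / Real.pi * √x := by
    rw [div_mul_eq_mul_div, one_le_div hpi]; linarith
  nlinarith

/-- With `u = log x`, the claim is that `log (2 / π) + log (u + log (4 / π))` is at most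
`u / (2 π) + log u / π`. A fraction `1 / π` of `log (u + log (4 / π))` is compared with `log u / π`
by concavity of `log`; the rest is bounded by the tangent of `log` at `exp (3 / 2)`, close to the
point where the inequality is tightest. -/
lemma log_polyaVinogradov_add_one_le {x : ℝ} (hx : 3 ≤ x) :
    Real.log (2 / Real.pi * √x * Real.log (4 * x / Real.pi)) + 1 ≤
      (1 / 2 + 1 / (2 * Real.pi)) * Real.log x + 1 / Real.pi * Real.log (Real.log x) + 1 := by
  have hpi := Real.pi_pos
  have hx0 : 0 < x := by linarith
  set u := Real.log x with hu
  have hu1 : 1.09 ≤ u := by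
    rw [hu, Real.le_log_iff_exp_le hx0, show (1.09 : ℝ) = 1 + 0.09 by norm_num, Real.exp_add]
    have h1 := Real.exp_one_lt_d9
    have h2 := Real.exp_bound_div_one_sub_of_interval (x := 0.09) (by norm_num) (by norm_num)
    norm_num at h2
    nlinarith [Real.exp_pos 1, Real.exp_pos 0.09]
  set l := Real.log (Real.pi / 2) with hl
  have hl1 : 0.45 ≤ l := by
    -- `exp y ≤ 1 / (1 - y)` is sharp enough only for small `y`, hence the 100th power
    rw [hl, Real.le_log_iff_exp_le (by positivity),
      show (0.45 : ℝ) = (100 : ℕ) * 0.0045 by norm_num, Real.exp_nat_mul]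
    have h2 := Real.exp_bound_div_one_sub_of_interval (x := 0.0045) (by norm_num) (by norm_num)
    have h3 := pow_le_pow_left₀ (Real.exp_pos _).le h2 100
    have h4 : ((1 : ℝ) / (1 - 0.0045)) ^ 100 ≤ 1.57 := by norm_num
    linarith [Real.pi_gt_d2]
  set b := Real.log 2 - l with hb
  have hb1 : b ≤ 0.2432 := by have := Real.log_two_lt_d9; norm_num at this ⊢; linarith
  have hb4 : Real.log (4 / Real.pi) = b := by
    rw [hb, hl, ← Real.log_div two_ne_zero (by positivity)]
    congr 1; field_simp; norm_num
  have hb0 : 0 < b := by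
    rw [← hb4]; exact Real.log_pos ((one_lt_div hpi).2 Real.pi_lt_four)
  have hw : Real.log (4 * x / Real.pi) = u + b := by
    rw [mul_div_right_comm, Real.log_mul (by positivity) hx0.ne', hb4, add_comm]
  have hlogM : Real.log (2 / Real.pi * √x * Real.log (4 * x / Real.pi)) =
      -l + u / 2 + Real.log (u + b) := by
    have hw0 : 0 < u + b := by linarith
    rw [hw, Real.log_mul (by positivity) hw0.ne', Real.log_mul (by positivity) (by positivity),
      Real.log_sqrt hx0.le, hl, ← Real.log_inv, inv_div]
  have hlu : Real.log (u + b) ≤ Real.log u + b / u := by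
    have h := Real.log_le_sub_one_of_pos (x := (u + b) / u) (by positivity)
    rw [Real.log_div (by linarith) (by linarith), add_div, div_self (by linarith)] at h
    linarith
  set E := Real.exp (-1.5) with hE
  have hE1 : E ≤ 0.22315 := by
    have h1 : E ^ 2 * Real.exp 1 ^ 3 = 1 := by
      rw [hE, ← Real.exp_nat_mul, ← Real.exp_nat_mul, ← Real.exp_add]
      norm_num
    have h2 : (20.085 : ℝ) ≤ Real.exp 1 ^ 3 :=
      le_trans (by norm_num) (pow_le_pow_left₀ (by norm_num) Real.exp_one_gt_d9.le 3)
    by_contra! h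
    nlinarith [pow_lt_pow_left₀ h (by norm_num) two_ne_zero]
  have hlw : Real.log (u + b) ≤ (u + b) * E + 0.5 := by
    have h := Real.log_le_sub_one_of_pos (x := (u + b) * E) (by positivity)
    rw [Real.log_mul (by linarith) (Real.exp_pos _).ne', hE, Real.log_exp] at h
    rw [hE]; norm_num at h ⊢; linarith
  have hbu : b / u ≤ 0.2232 := by
    rw [div_le_iff₀ (by linarith)]; norm_num at hu1 hb1 ⊢; linarith
  set I := 1 / Real.pi with hI
  have hI1 : 0.3183 ≤ I := by
    rw [hI, le_div_iff₀ hpi]; have := Real.pi_lt_d4; norm_num at this ⊢; linarith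
  have hI2 : I ≤ 0.31832 := by
    rw [hI, div_le_iff₀ hpi]; have := Real.pi_gt_d4; norm_num at this ⊢; linarith
  have hI3 : 1 / (2 * Real.pi) = I / 2 := by rw [hI]; field_simp
  have hA : (1 - I) * Real.log (u + b) ≤ 0.6817 * ((u + 0.2432) * 0.22315 + 0.5) := by
    have h1 : (u + b) * E + 0.5 ≤ (u + 0.2432) * 0.22315 + 0.5 := by gcongr
    refine mul_le_mul (by norm_num at hI1 ⊢; linarith) (hlw.trans h1) ?_ (by norm_num)
    exact Real.log_nonneg (by linarith)
  have hB : I * Real.log (u + b) ≤ I * Real.log u + 0.31832 * 0.2232 := by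
    have h1 : I * Real.log (u + b) ≤ I * (Real.log u + b / u) := by gcongr
    have h2 : I * (b / u) ≤ 0.31832 * 0.2232 := by gcongr
    linarith
  rw [hlogM, hI3]
  have hC : 0.3183 * u ≤ I * u := by gcongr
  norm_num at hA hB hC hl1 hu1
  linarith

/-! ### The bound for `L(1, χ)` -/

theorem mainTheorem2 (d : ℤ) (hd : d < 0) [NeZero d.natAbs]
    (χ : DirichletCharacter ℂ d.natAbs)
    (hχ : ∀ m : ℤ, χ (m : ZMod d.natAbs) = (kroneckerSymbol d m : ℂ)) :
    ∃ L : ℝ,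
      DirichletCharacter.LFunction χ 1 = (L : ℂ) ∧
      Filter.Tendsto
        (fun N : ℕ => ∑ n ∈ Finset.Icc 1 N, χ (n : ZMod d.natAbs) / (n : ℂ))
        Filter.atTop (nhds (L : ℂ)) ∧
      L ≤ (1 / 2 + 1 / (2 * Real.pi)) * Real.log |(d : ℝ)| +
        1 / Real.pi * Real.log (Real.log |(d : ℝ)|) + 1 := by
  have hodd : χ (-1) = -1 := by
    have := hχ (-1)
    rw [kroneckerSymbol_neg_one_right hd] at this
    simpa using this
  have hχ1 : χ ≠ 1 := by
    rintro rfl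
    rw [MulChar.one_apply isUnit_one.neg] at hodd
    norm_num at hodd
  have hq3 : 3 ≤ d.natAbs := by
    have h0 := NeZero.ne d.natAbs
    -- modulo `1` and `2` one has `-1 = 1`
    have hne : (-1 : ZMod d.natAbs) ≠ 1 := fun h ↦ by
      rw [h, map_one] at hodd; norm_num at hodd
    by_contra! hlt
    refine hne ?_
    rw [neg_eq_iff_add_eq_zero, one_add_one_eq_two, ← Nat.cast_ofNat,
      ZMod.natCast_eq_zero_iff]
    interval_cases d.natAbs <;> simp_all
  have hqd : ((d.natAbs : ℕ) : ℝ) = |(d : ℝ)| := by rw [Nat.cast_natAbs, Int.cast_abs]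
  have hx3 : 3 ≤ |(d : ℝ)| := by rw [← hqd]; exact_mod_cast hq3
  have hPV := norm_partialSum_le_of_sq_dvd hχ1 fun p ↦ sq_dvd_of_not_dvd_conductor hχ
  have hχ0 : χ ((0 : ℕ) : ZMod d.natAbs) = 0 := by
    rw [Nat.cast_zero]; exact χ.map_zero' (by omega)
  have hlim := tendsto_sum_div_of_bounded_partialSum (c := fun n ↦ χ (n : ZMod d.natAbs)) hχ0 hPV
  have hnorm := norm_integral_partialSum_le (c := fun n ↦ χ (n : ZMod d.natAbs))
    (fun n ↦ χ.norm_le_one n) (one_le_polyaVinogradov (by exact_mod_cast hq3)) hPV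
  rw [← LFunction_one_eq_integral hχ1 hPV] at hlim hnorm
  have him : (DirichletCharacter.LFunction χ 1).im = 0 := by
    refine tendsto_nhds_unique ((Complex.continuous_im.tendsto _).comp hlim)
      (tendsto_const_nhds.congr fun N ↦ ?_)
    simp only [Function.comp, Complex.im_sum]
    refine (Finset.sum_eq_zero fun n _ ↦ ?_).symm
    have := hχ n
    rw [Int.cast_natCast] at this
    rw [this, Complex.div_natCast_im, Complex.intCast_im, zero_div]
  have hre : DirichletCharacter.LFunction χ 1 = ((DirichletCharacter.LFunction χ 1).re : ℂ) :=
    Complex.ext (by simp) (by simpa using him)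
  refine ⟨_, hre, hre ▸ hlim, ?_⟩
  refine ((Complex.re_le_norm _).trans hnorm).trans ?_
  rw [hqd]
  exact log_polyaVinogradov_add_one_le hx3
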